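/- Let $p,q\ge 0$ be integers with $n=p+q\ge 1$, let $I_{p,q}=\mathrm{diag}(I_p,-I_q)$, and let $$\mathfrak h=\mathfrak{sp}(p,q)=\{X\in M_{n}(\mathbb H): X^*I_{p,q}+I_{p,q}X=0\}$$ be the real Lie algebra with the commutator bracket, equipped with the bilinear form $B(X,Y)=\mathrm{Re}\,\mathrm{tr}(XY)$. Fix a coordinate $o\in\{1,\dots,n\}$. Let $\mathfrak g\subset\mathfrak h$ be the subalgebra of matrices whose $o$-th row and column vanish (so $\mathfrak g\cong\mathfrak{sp}(p-1,q)$ if $o\le p$ and $\mathfrak g\cong\mathfrak{sp}(p,q-1)$ if $o>p$), let $\mathfrak k\cong\mathfrak{sp}(1)$ be the subalgebra of matrices whose only possibly nonzero entry is the $(o,o)$ entry, and let $\mathfrak p\subset\mathfrak h$ be the subspace of matrices $X$ with $X_{oo}=0$ and $X_{ij}=0$ for all $i,j\ne o$. Then $\mathfrak h=\mathfrak g\oplus\mathfrak k\oplus\mathfrak p$ is a $B$-orthogonal decomposition. Put $\mathfrak m=\mathfrak g\oplus\mathfrak p$, and for $x\in\mathfrak h$, $y\in\mathfrak m$ let $\widetilde{\mathrm{ad}}_x(y)=[x,y]_{\mathfrak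 m}$ be the $B$-orthogonal projection onto $\mathfrak m$ of the bracket $[x,y]$ of $\mathfrak h$. Regard $\mathfrak m$ as a (non-associative) real algebra with product $(x,y)\mapsto[x,y]_{\mathfrak m}$, and let $$\mathrm{Der}(\mathfrak m)=\{T\in\mathrm{End}_{\mathbb R}(\mathfrak m): T[x,y]_{\mathfrak m}=[Tx,y]_{\mathfrak m}+[x,Ty]_{\mathfrak m}\ \text{ for all } x,y\in\mathfrak m\}.$$ Proposition. For $x\in\mathfrak g\oplus\mathfrak k$ one has $[x,\mathfrak m]\subset\mathfrak m$, so that $\widetilde{\mathrm{ad}}_x=\mathrm{ad}_x|_{\mathfrak m}$, and $$\mathrm{Der}(\mathfrak m)=\widetilde{\mathrm{ad}}(\mathfrak g\oplus\mathfrak k).$$ Moreover, if $x\in\mathfrak p$ and $\widetilde{\mathrm{ad}}_x\in\mathrm{Der}(\mathfrak m)$, then $x=0$. -/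

import Mathlib

open scoped Quaternion

attribute [local instance] LieRing.ofAssociativeRing

namespace QSp

/-- The matrix `I_{p,q} = diag(1,…,1,-1,…,-1)` of the quaternionic hermitian form on `ℍ^{p,q}`. -/
noncomputable def form (p q : ℕ) : Matrix (Fin p ⊕ Fin q) (Fin p ⊕ Fin q) ℍ[ℝ] :=
  Matrix.diagonal (Sum.elim (fun _ => 1) (fun _ => -1))

/-- The real Lie algebra `𝔰𝔭(p,q)` of quaternionic matrices `X` with `X^* I_{p,q} + I_{p,q} X = 0`,
with the commutator bracket. -/
noncomputable def sp (p q : ℕ) : LieSubalgebra ℝ (Matrix (Fin p ⊕ Fin q) (Fin p ⊕ Fin q) ℍ[ℝ]) where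
  carrier := {X | X.conjTranspose * form p q + form p q * X = 0}
  add_mem' {X Y} hX hY := by
    simp only [Set.mem_ofPred_eq, Matrix.conjTranspose_add, add_mul, mul_add] at *
    rw [add_add_add_comm, hX, hY, add_zero]
  zero_mem' := by simp
  smul_mem' c X hX := by
    have h : (c • X).conjTranspose = c • X.conjTranspose := by
      ext1 i j
      simp [Matrix.conjTranspose_apply, Quaternion.star_smul]
    simp only [Set.mem_ofPred_eq, h, Matrix.smul_mul, Matrix.mul_smul] at *
    rw [← smul_add, hX, smul_zero]
  lie_mem' {X Y} hX hY := by
    have hX' : X.conjTranspose * form p q = -(form p q * X) := eq_neg_of_add_eq_zero_left hX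
    have hY' : Y.conjTranspose * form p q = -(form p q * Y) := eq_neg_of_add_eq_zero_left hY
    simp only [Set.mem_ofPred_eq, Ring.lie_def, Matrix.conjTranspose_sub,
      Matrix.conjTranspose_mul, sub_mul, mul_sub, mul_assoc, hX', hY', mul_neg]
    simp only [← mul_assoc, hX', hY', neg_mul]
    abel

variable {p q : ℕ}

theorem mem_sp {X : Matrix (Fin p ⊕ Fin q) (Fin p ⊕ Fin q) ℍ[ℝ]} :
    X ∈ sp p q ↔ X.conjTranspose * form p q + form p q * X = 0 := Iff.rfl

theorem mem_sp_iff_entries {X : Matrix (Fin p ⊕ Fin q) (Fin p ⊕ Fin q) ℍ[ℝ]} :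
    X ∈ sp p q ↔ ∀ i j, star (X j i) * Sum.elim (fun _ => (1 : ℍ[ℝ])) (fun _ => -1) j +
      Sum.elim (fun _ => (1 : ℍ[ℝ])) (fun _ => -1) i * X i j = 0 := by
  rw [mem_sp, ← Matrix.ext_iff]
  simp only [form, Matrix.add_apply, Matrix.mul_diagonal, Matrix.diagonal_mul,
    Matrix.conjTranspose_apply, Matrix.zero_apply]

/-- The bilinear form `B(X,Y) = Re tr(XY)` on `𝔰𝔭(p,q)`. -/
noncomputable def B (X Y : sp p q) : ℝ :=
  (Matrix.trace (X.1 * Y.1)).re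

/-- Replace by zero the entries of `X` outside a symmetric set `s` of positions. -/
noncomputable def mask (s : Fin p ⊕ Fin q → Fin p ⊕ Fin q → Prop) [∀ i j, Decidable (s i j)]
    (hs : ∀ i j, s i j → s j i) : sp p q →ₗ[ℝ] sp p q where
  toFun X := ⟨Matrix.of fun i j => if s i j then X.1 i j else 0, by
    have hX := mem_sp_iff_entries.1 X.2
    rw [mem_sp_iff_entries]
    intro i j
    by_cases h : s i j
    · simpa [h, hs i j h] using hX i j
    · have h' : ¬ s j i := fun h' => h (hs j i h')
      simp [h, h']⟩
  map_add' X Y := by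
    ext1; ext1 i j
    by_cases h : s i j <;> simp [h]
  map_smul' c X := by
    ext1; ext1 i j
    by_cases h : s i j <;> simp [h]

theorem mask_apply (s : Fin p ⊕ Fin q → Fin p ⊕ Fin q → Prop) [∀ i j, Decidable (s i j)]
    (hs : ∀ i j, s i j → s j i) (X : sp p q) (i j : Fin p ⊕ Fin q) :
    (mask s hs X).1 i j = if s i j then X.1 i j else 0 := rfl

/-- The subalgebra `𝔤` of `𝔰𝔭(p,q)`: the block belonging to all coordinates but the `o`-th, so
`𝔰𝔭(p-1,q)` if `o` is one of the first `p` coordinates and `𝔰𝔭(p,q-1)` if it is one of the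
last `q`. -/
noncomputable def g (o : Fin p ⊕ Fin q) : LieSubalgebra ℝ (sp p q) where
  carrier := {X | ∀ i, X.1 o i = 0 ∧ X.1 i o = 0}
  add_mem' {X Y} hX hY i := by simp [hX i, hY i]
  zero_mem' i := by simp
  smul_mem' c X hX i := by simp [hX i]
  lie_mem' {X Y} hX hY i := by
    have h1 : ∀ j, X.1 o j = 0 := fun j => (hX j).1
    have h2 : ∀ j, X.1 j o = 0 := fun j => (hX j).2
    have h3 : ∀ j, Y.1 o j = 0 := fun j => (hY j).1
    have h4 : ∀ j, Y.1 j o = 0 := fun j => (hY j).2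
    simp [Ring.lie_def, Matrix.mul_apply, h1, h2, h3, h4]

/-- The subalgebra `𝔨 ≅ 𝔰𝔭(1)` of `𝔰𝔭(p,q)`: the `1 × 1` block of the `o`-th coordinate. -/
noncomputable def k (o : Fin p ⊕ Fin q) : LieSubalgebra ℝ (sp p q) where
  carrier := {X | ∀ i j, ¬ (i = o ∧ j = o) → X.1 i j = 0}
  add_mem' {X Y} hX hY i j h := by simp [hX i j h, hY i j h]
  zero_mem' i j h := by simp
  smul_mem' c X hX i j h := by simp [hX i j h]
  lie_mem' {X Y} hX hY i j h := by
    have h1 : ∀ a, X.1 i a * Y.1 a j = 0 := fun a => by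
      by_cases hi : i = o ∧ a = o
      · rw [hY a j (fun h' => h ⟨hi.1, h'.2⟩), mul_zero]
      · rw [hX i a hi, zero_mul]
    have h2 : ∀ a, Y.1 i a * X.1 a j = 0 := fun a => by
      by_cases hi : i = o ∧ a = o
      · rw [hX a j (fun h' => h ⟨hi.1, h'.2⟩), mul_zero]
      · rw [hY i a hi, zero_mul]
    simp [Ring.lie_def, Matrix.mul_apply, h1, h2]

/-- The complement `𝔭 ≅ ℍ^{n-1}` of `𝔤 ⊕ 𝔨` in `𝔰𝔭(p,q)`: the off-diagonal blocks. -/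
noncomputable def P (o : Fin p ⊕ Fin q) : Submodule ℝ (sp p q) where
  carrier := {X | ∀ i j, (i = o ↔ j = o) → X.1 i j = 0}
  add_mem' {X Y} hX hY i j h := by simp [hX i j h, hY i j h]
  zero_mem' i j h := by simp
  smul_mem' c X hX i j h := by simp [hX i j h]

theorem mem_g {o : Fin p ⊕ Fin q} {X : sp p q} :
    X ∈ g o ↔ ∀ i, X.1 o i = 0 ∧ X.1 i o = 0 := Iff.rfl

theorem mem_k {o : Fin p ⊕ Fin q} {X : sp p q} :
    X ∈ k o ↔ ∀ i j, ¬ (i = o ∧ j = o) → X.1 i j = 0 := Iff.rfl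

theorem mem_P {o : Fin p ⊕ Fin q} {X : sp p q} :
    X ∈ P o ↔ ∀ i j, (i = o ↔ j = o) → X.1 i j = 0 := Iff.rfl

/-- The subspace `𝔪 = 𝔤 ⊕ 𝔭` of `𝔰𝔭(p,q)`. -/
noncomputable def m (o : Fin p ⊕ Fin q) : Submodule ℝ (sp p q) :=
  (g o).toSubmodule ⊔ P o

theorem mem_m {o : Fin p ⊕ Fin q} {X : sp p q} : X ∈ m o ↔ X.1 o o = 0 := by
  constructor
  · intro h
    obtain ⟨Y, hY, Z, hZ, rfl⟩ := Submodule.mem_sup.1 h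
    have h1 : Y.1 o o = 0 := (mem_g.1 hY o).1
    have h2 : Z.1 o o = 0 := mem_P.1 hZ o o Iff.rfl
    simp [h1, h2]
  · intro h
    refine Submodule.mem_sup.2
      ⟨mask (fun i j => i ≠ o ∧ j ≠ o) (fun i j h => ⟨h.2, h.1⟩) X, ?_,
        mask (fun i j => ¬ (i = o ↔ j = o)) (fun i j h h' => h h'.symm) X, ?_, ?_⟩
    · exact mem_g.2 fun i => by simp [mask_apply]
    · exact mem_P.2 fun i j hij => by simp [mask_apply, hij]
    · ext1; ext1 i j
      change (mask _ _ X).1 i j + (mask _ _ X).1 i j = X.1 i j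
      simp only [mask_apply]
      by_cases hi : i = o <;> by_cases hj : j = o <;> simp [hi, hj, h]

/-- The projection `𝔰𝔭(p,q) = 𝔨 ⊕ 𝔪 → 𝔪` with kernel `𝔨`. It deletes the `(o,o)` entry. It is the
orthogonal projection for `B`: see `sub_proj_mem_k` and `B_eq_zero_of_mem_k_of_mem_m`. -/
noncomputable def proj (o : Fin p ⊕ Fin q) : sp p q →ₗ[ℝ] m o :=
  (mask (fun i j => ¬ (i = o ∧ j = o)) (fun _ _ h h' => h ⟨h'.2, h'.1⟩)).codRestrict (m o)
    fun X => mem_m.2 (by simp [mask_apply])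

theorem proj_apply (o : Fin p ⊕ Fin q) (X : sp p q) (i j : Fin p ⊕ Fin q) :
    (proj o X).1.1 i j = if ¬ (i = o ∧ j = o) then X.1 i j else 0 := rfl

theorem sub_proj_mem_k (o : Fin p ⊕ Fin q) (X : sp p q) : X - (proj o X).1 ∈ k o := by
  refine mem_k.2 fun i j h => ?_
  change X.1 i j - (proj o X).1.1 i j = 0
  rw [proj_apply, if_pos h, sub_self]

/-- `𝔪` is orthogonal to `𝔨` with respect to `B`. -/
theorem B_eq_zero_of_mem_k_of_mem_m {o : Fin p ⊕ Fin q} {X Y : sp p q}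
    (hX : X ∈ k o) (hY : Y ∈ m o) : B X Y = 0 := by
  have h : ∀ i j, X.1 i j * Y.1 j i = 0 := fun i j => by
    by_cases hij : i = o ∧ j = o
    · rw [hij.1, hij.2, mem_m.1 hY, mul_zero]
    · rw [mem_k.1 hX i j hij, zero_mul]
  simp [B, Matrix.trace, Matrix.mul_apply, h]

/-- `𝔭` is orthogonal to `𝔤` with respect to `B`. -/
theorem B_eq_zero_of_mem_g_of_mem_P {o : Fin p ⊕ Fin q} {X Y : sp p q}
    (hX : X ∈ g o) (hY : Y ∈ P o) : B X Y = 0 := by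
  have h : ∀ i j, X.1 i j * Y.1 j i = 0 := fun i j => by
    by_cases hi : i = o
    · rw [hi, (mem_g.1 hX j).1, zero_mul]
    · by_cases hj : j = o
      · rw [hj, (mem_g.1 hX i).2, zero_mul]
      · rw [mem_P.1 hY j i (by simp [hi, hj]), mul_zero]
  simp [B, Matrix.trace, Matrix.mul_apply, h]

theorem isCompl_k_m (o : Fin p ⊕ Fin q) : IsCompl (k o).toSubmodule (m o) := by
  constructor
  · refine Submodule.disjoint_def.2 fun X hX hY => ?_
    ext1; ext1 i j
    by_cases h : i = o ∧ j = o
    · rw [h.1, h.2]; exact mem_m.1 hY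
    · exact mem_k.1 hX i j h
  · refine codisjoint_iff.2 (Submodule.eq_top_iff'.2 fun X => Submodule.mem_sup.2 ?_)
    exact ⟨_, sub_proj_mem_k o X, _, (proj o X).2, sub_add_cancel _ _⟩

theorem disjoint_g_P (o : Fin p ⊕ Fin q) : Disjoint (g o).toSubmodule (P o) := by
  refine Submodule.disjoint_def.2 fun X hX hY => ?_
  ext1; ext1 i j
  by_cases hi : i = o
  · rw [hi]; exact (mem_g.1 hX j).1
  · by_cases hj : j = o
    · rw [hj]; exact (mem_g.1 hX i).2
    · exact mem_P.1 hY i j (by simp [hi, hj])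

/-- If `o` is the first coordinate, `𝔤` consists of the matrices with zero first row and column and
with complementary block in `𝔰𝔭(p,q)`, as a subset of `𝔰𝔭(p+1,q)`. -/
theorem exists_mem_g_inl_iff {X : Matrix (Fin (p + 1) ⊕ Fin q) (Fin (p + 1) ⊕ Fin q) ℍ[ℝ]} :
    (∃ h : X ∈ sp (p + 1) q, (⟨X, h⟩ : sp (p + 1) q) ∈ g (Sum.inl 0)) ↔
      (∀ i, X (Sum.inl 0) i = 0 ∧ X i (Sum.inl 0) = 0) ∧
        X.submatrix (Sum.map Fin.succ id) (Sum.map Fin.succ id) ∈ sp p q := by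
  simp only [mem_g, mem_sp_iff_entries, Sum.forall, Fin.forall_fin_succ]
  simp
  grind [star_zero]

/-- If `o` is the last coordinate, `𝔤` consists of the matrices with zero last row and column and
with complementary block in `𝔰𝔭(p,q)`, as a subset of `𝔰𝔭(p,q+1)`. -/
theorem exists_mem_g_inr_iff {X : Matrix (Fin p ⊕ Fin (q + 1)) (Fin p ⊕ Fin (q + 1)) ℍ[ℝ]} :
    (∃ h : X ∈ sp p (q + 1), (⟨X, h⟩ : sp p (q + 1)) ∈ g (Sum.inr (Fin.last q))) ↔
      (∀ i, X (Sum.inr (Fin.last q)) i = 0 ∧ X i (Sum.inr (Fin.last q)) = 0) ∧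
        X.submatrix (Sum.map id Fin.castSucc) (Sum.map id Fin.castSucc) ∈ sp p q := by
  simp only [mem_g, mem_sp_iff_entries, Sum.forall, Fin.forall_fin_succ']
  simp
  grind [star_zero]

/-- The map `x ↦ (y ↦ [x,y]_𝔪)` from `𝔰𝔭(p,q)` to the endomorphisms of `𝔪`, where `[x,y]_𝔪` is the
projection onto `𝔪` of the Lie bracket of `𝔰𝔭(p,q)`. -/
noncomputable def adm (o : Fin p ⊕ Fin q) : sp p q →ₗ[ℝ] Module.End ℝ (m o) :=
  LinearMap.mk₂ ℝ (fun (x : sp p q) (y : m o) => proj o ⁅x, (y : sp p q)⁆)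
    (fun x x' y => by rw [add_lie, map_add])
    (fun c x y => by rw [smul_lie, map_smul])
    (fun x y y' => by rw [Submodule.coe_add, lie_add, map_add])
    (fun c x y => by rw [Submodule.coe_smul, lie_smul, map_smul])

theorem adm_apply (o : Fin p ⊕ Fin q) (x : sp p q) (y : m o) :
    adm o x y = proj o ⁅x, (y : sp p q)⁆ := rfl

/-- The product `[x,y]_𝔪` of the non-associative algebra `𝔪`. -/
noncomputable def mul (o : Fin p ⊕ Fin q) (x y : m o) : m o :=
  proj o ⁅(x : sp p q), (y : sp p q)⁆

theorem mul_eq_adm (o : Fin p ⊕ Fin q) (x y : m o) : mul o x y = adm o x y := rfl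

/-- The Lie algebra `Der(𝔪)` of derivations of the non-associative algebra `(𝔪, [·,·]_𝔪)`. -/
noncomputable def der (o : Fin p ⊕ Fin q) : LieSubalgebra ℝ (Module.End ℝ (m o)) where
  carrier := {T | ∀ x y, T (mul o x y) = mul o (T x) y + mul o x (T y)}
  add_mem' {S T} hS hT x y := by
    simp only [LinearMap.add_apply, hS x y, hT x y]
    simp only [mul_eq_adm, Submodule.coe_add, map_add, LinearMap.add_apply]
    abel
  zero_mem' x y := by simp [mul_eq_adm]
  smul_mem' c T hT x y := by
    simp only [LinearMap.smul_apply, hT x y]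
    simp only [mul_eq_adm, Submodule.coe_smul, map_smul, LinearMap.smul_apply, smul_add]
  lie_mem' {S T} hS hT x y := by
    have hS' : ∀ x y, S (mul o x y) = mul o (S x) y + mul o x (S y) := hS
    have hT' : ∀ x y, T (mul o x y) = mul o (T x) y + mul o x (T y) := hT
    simp only [Ring.lie_def, LinearMap.sub_apply, Module.End.mul_apply, hS', hT', map_add]
    simp only [mul_eq_adm, Submodule.coe_sub, map_sub, LinearMap.sub_apply]
    abel

end QSp

/-!
The algebra `𝔪 = 𝔤 ⊕ 𝔭` is `ℤ/2`-graded, and the projection onto `𝔪` commutes with the action of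
`𝔤 ⊕ 𝔨` (`QSp.coe_proj_lie`). Hence the Jacobi identity survives in `𝔪` as soon as one of the
elements lies in `𝔤 ⊕ 𝔨` (`QSp.adm_adm`), which gives the first assertion and the inclusion
`ad(𝔤 ⊕ 𝔨) ⊆ Der(𝔪)`.

For the converse, `𝔤` contains a copy of `𝔰𝔭(1)`, the imaginary quaternions times the identity
on the coordinates other than `o` (`QSp.scal`). It acts on the entries of `𝔤` by commutators and on
those of the column `𝔭 ≅ ℍⁿ⁻¹` by left multiplication. Its first cohomology with values in `𝔪`
vanishes, with an explicit primitive given by the Casimir operator, so a derivation `T` agrees on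
it with `ad x + ad v` for some `x ∈ 𝔤` and `v ∈ 𝔭` (`QSp.exists_eq_adm_on_scal`). Although `ad v`
need not be a derivation, `D = T - ad x - ad v` still satisfies the Leibniz rule for products with
one factor in `𝔤` (`QSp.sub_adm_leibniz`), so it commutes with the action of `𝔰𝔭(1)`. Since the
unit `i` has disjoint sets of eigenvalues on `𝔤` and on `𝔭`, the map `D` preserves both. On
`𝔭 ≅ ℍⁿ⁻¹` it is left `ℍ`-linear, hence given by a quaternionic matrix `φ` (`QSp.phi`). The
Leibniz rule forces `φ` to be the sum of a real matrix, skew for the form and so an element of `𝔤`,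
and a scalar, which is imaginary by the Leibniz rule on `𝔭` and so comes from `𝔨`. Since `𝔤` acts
faithfully on `𝔭`, this determines `D` on `𝔤` as well, and `D ∈ ad(𝔤 ⊕ 𝔨)`
(`QSp.IsRelDer.exists_eq_adm`).

Then `ad v` is itself a derivation. Testing it on elements of `𝔭` whose columns are multiples of
one basis vector by quaternion units shows that `v = 0` (`QSp.eq_zero_of_adm_mem_der`), which is
also the last assertion.
-/

namespace QSp

variable {p q : ℕ} {o : Fin p ⊕ Fin q}

/-! ### Entries of the elements of `𝔪`, and the action of `𝔤 ⊕ 𝔨` -/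

/-- The diagonal entries `±1` of `I_{p,q}`, as real numbers. -/
def sgn (i : Fin p ⊕ Fin q) : ℝ := Sum.elim (fun _ => 1) (fun _ => -1) i

theorem sgn_mul_self (i : Fin p ⊕ Fin q) : sgn i * sgn i = 1 := by
  cases i <;> simp [sgn]

theorem mem_sp_iff_apply_eq {X : Matrix (Fin p ⊕ Fin q) (Fin p ⊕ Fin q) ℍ[ℝ]} :
    X ∈ sp p q ↔ ∀ i j, X i j = -((sgn i * sgn j) • star (X j i)) := by
  rw [mem_sp_iff_entries]
  refine forall₂_congr fun i j => ?_
  cases i <;> cases j <;> simp [sgn] <;> grind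

theorem apply_eq (X : sp p q) (i j : Fin p ⊕ Fin q) :
    X.1 i j = -((sgn i * sgn j) • star (X.1 j i)) :=
  mem_sp_iff_apply_eq.1 X.2 i j

/-- An element of `𝔪` is determined by its entries outside the `o`-th row. -/
theorem m_ext {y z : m o} (h : ∀ i j, i ≠ o → y.1.1 i j = z.1.1 i j) : y = z := by
  ext1; ext1; ext1 i j
  by_cases hi : i = o
  · subst hi
    by_cases hj : j = i
    · subst hj; rw [mem_m.1 y.2, mem_m.1 z.2]
    · rw [apply_eq y.1, apply_eq z.1, h j i hj]
  · exact h i j hi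

theorem adm_apply_apply (x : sp p q) (y : m o) {i j : Fin p ⊕ Fin q} (h : ¬ (i = o ∧ j = o)) :
    (adm o x y).1.1 i j = ∑ c, x.1 i c * y.1.1 c j - ∑ c, y.1.1 i c * x.1 c j := by
  rw [adm_apply, proj_apply, if_pos h]
  simp [Ring.lie_def, Matrix.mul_apply]

theorem apply_eq_zero_of_mem_sup {x : sp p q} (hx : x ∈ (g o).toSubmodule ⊔ (k o).toSubmodule)
    {i : Fin p ⊕ Fin q} (hi : i ≠ o) : x.1 o i = 0 ∧ x.1 i o = 0 := by
  obtain ⟨a, ha, b, hb, rfl⟩ := Submodule.mem_sup.1 hx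
  have h1 := mem_g.1 ha i
  have h2 := mem_k.1 hb o i (by simp [hi])
  have h3 := mem_k.1 hb i o (by simp [hi])
  simp [h1, h2, h3]

/-- The projection onto `𝔪` commutes with the action of `𝔤 ⊕ 𝔨`. -/
theorem coe_proj_lie {x : sp p q} (hx : x ∈ (g o).toSubmodule ⊔ (k o).toSubmodule) (y : sp p q) :
    (proj o ⁅x, y⁆ : sp p q) = ⁅x, (proj o y : sp p q)⁆ := by
  ext1; ext1 i j
  rw [proj_apply]
  have h := @apply_eq_zero_of_mem_sup _ _ _ _ hx
  change _ = (x.1 * (proj o y).1.1 - (proj o y).1.1 * x.1) i j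
  rw [Matrix.sub_apply, Matrix.mul_apply, Matrix.mul_apply]
  simp only [proj_apply]
  by_cases hij : i = o ∧ j = o
  · obtain ⟨rfl, rfl⟩ := hij
    rw [if_neg (by simp), Finset.sum_eq_zero, Finset.sum_eq_zero, sub_zero]
    · intro c _
      by_cases hc : c = j
      · simp [hc]
      · simp [(h hc).2]
    · intro c _
      by_cases hc : c = j
      · simp [hc]
      · simp [(h hc).1]
  · rw [if_pos hij]
    change (x.1 * y.1 - y.1 * x.1) i j = _
    rw [Matrix.sub_apply, Matrix.mul_apply, Matrix.mul_apply]
    congr 1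
    · refine Finset.sum_congr rfl fun c _ => ?_
      by_cases hc : c = o ∧ j = o
      · have hi : i ≠ o := fun h' => hij ⟨h', hc.2⟩
        simp [hc.1, (h hi).2]
      · rw [if_pos hc]
    · refine Finset.sum_congr rfl fun c _ => ?_
      by_cases hc : i = o ∧ c = o
      · have hi : j ≠ o := fun h' => hij ⟨hc.1, h'⟩
        simp [hc.2, (h hi).1]
      · rw [if_pos hc]

theorem proj_coe (y : m o) : proj o (y : sp p q) = y := by
  refine m_ext fun i j hi => ?_
  rw [proj_apply, if_pos (by simp [hi])]

theorem coe_adm {x : sp p q} (hx : x ∈ (g o).toSubmodule ⊔ (k o).toSubmodule) (y : m o) :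
    (adm o x y : sp p q) = ⁅x, (y : sp p q)⁆ := by
  rw [adm_apply, coe_proj_lie hx, proj_coe]

/-- The Jacobi identity survives the projection when one of the elements lies in `𝔤 ⊕ 𝔨`. -/
theorem adm_adm {a : sp p q} (ha : a ∈ (g o).toSubmodule ⊔ (k o).toSubmodule) (x : sp p q)
    (z : m o) : adm o a (adm o x z) = adm o ⁅a, x⁆ z + adm o x (adm o a z) := by
  have h : adm o a (adm o x z) = proj o ⁅a, ⁅x, (z : sp p q)⁆⁆ := by
    ext1
    rw [coe_adm ha, adm_apply, coe_proj_lie ha]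
  rw [h, adm_apply, adm_apply o x, coe_adm ha, ← map_add, leibniz_lie]

theorem adm_mem_der {a : sp p q} (ha : a ∈ (g o).toSubmodule ⊔ (k o).toSubmodule) :
    adm o a ∈ der o := by
  intro x y
  rw [mul_eq_adm, mul_eq_adm, mul_eq_adm, adm_adm ha, coe_adm ha]

theorem mem_sup_of_mem_g {a : sp p q} (ha : a ∈ g o) :
    a ∈ (g o).toSubmodule ⊔ (k o).toSubmodule :=
  Submodule.mem_sup_left ha

theorem adm_swap (x y : m o) : adm o x y = -adm o y x := by
  rw [adm_apply, adm_apply, ← lie_skew, map_neg]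

/-- The linear map `y ↦ T y - [x,y]_𝔪`, for `T` a derivation and `x ∈ 𝔪`, satisfies the Leibniz
rule for products with one factor in `𝔤`, although `y ↦ [x,y]_𝔪` need not be a derivation. -/
theorem sub_adm_leibniz {T : Module.End ℝ (m o)} (hT : T ∈ der o) (x : m o) {a : m o}
    (ha : a.1 ∈ g o) (z : m o) :
    (T - adm o x) (adm o a z) = adm o ((T - adm o x) a : m o) z + adm o a ((T - adm o x) z) := by
  have h1 : T (adm o a z) = adm o (T a) z + adm o a (T z) := hT a z
  have h2 := adm_adm (mem_sup_of_mem_g ha) x z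
  have h3 : (adm o x a : sp p q) = -⁅(a : sp p q), (x : sp p q)⁆ := by
    rw [← coe_adm (mem_sup_of_mem_g ha) x, adm_swap]
    rfl
  simp only [LinearMap.sub_apply, h1, map_sub, Submodule.coe_sub, h2, h3, map_neg,
    LinearMap.neg_apply]
  abel

/-- The element of `𝔤` which is diagonal with entries the imaginary parts of `d c`, for `c ≠ o`. -/
noncomputable def diagG (o : Fin p ⊕ Fin q) (d : Fin p ⊕ Fin q → ℍ[ℝ]) : m o :=
  ⟨⟨Matrix.diagonal fun c => if c = o then 0 else (d c).im, mem_sp_iff_apply_eq.2 fun i j => by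
    by_cases h : i = j
    · subst h
      by_cases hi : i = o <;> simp [hi, sgn_mul_self]
    · simp [h, Ne.symm h]⟩, mem_m.2 (by simp)⟩

theorem diagG_mem (d : Fin p ⊕ Fin q → ℍ[ℝ]) : (diagG o d).1 ∈ g o :=
  mem_g.2 fun i => by
    by_cases hi : i = o
    · subst hi; simp [diagG]
    · simp [diagG, hi, Ne.symm hi]

theorem diagG_apply (d : Fin p ⊕ Fin q → ℍ[ℝ]) (i j : Fin p ⊕ Fin q) :
    (diagG o d).1.1 i j = if i = j then (if i = o then 0 else (d i).im) else 0 := by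
  simp [diagG, Matrix.diagonal_apply]

theorem adm_diagG_apply (d : Fin p ⊕ Fin q → ℍ[ℝ]) (z : m o) {i j : Fin p ⊕ Fin q}
    (h : ¬ (i = o ∧ j = o)) :
    (adm o (diagG o d) z).1.1 i j = (if i = o then 0 else (d i).im) * z.1.1 i j -
      z.1.1 i j * (if j = o then 0 else (d j).im) := by
  rw [adm_apply_apply _ _ h]
  simp only [diagG_apply]
  simp

theorem adm_apply_diagG (d : Fin p ⊕ Fin q → ℍ[ℝ]) (z : m o) {i j : Fin p ⊕ Fin q}
    (h : ¬ (i = o ∧ j = o)) :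
    (adm o z (diagG o d)).1.1 i j = z.1.1 i j * (if j = o then 0 else (d j).im) -
      (if i = o then 0 else (d i).im) * z.1.1 i j := by
  rw [adm_apply_apply _ _ h]
  simp only [diagG_apply]
  simp

/-- The element of `𝔭` with entries `w i` in the `o`-th column, for `i ≠ o`. -/
noncomputable def col (o : Fin p ⊕ Fin q) : (Fin p ⊕ Fin q → ℍ[ℝ]) →ₗ[ℝ] m o where
  toFun w := ⟨⟨Matrix.of fun i j => if i = o then (if j = o then 0 else
      -((sgn i * sgn j) • star (w j))) else if j = o then w i else 0,
    mem_sp_iff_apply_eq.2 fun i j => by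
      have h : (sgn i * sgn j) * (sgn j * sgn i) = 1 := by
        rw [mul_mul_mul_comm, mul_comm (sgn j), mul_mul_mul_comm, sgn_mul_self, sgn_mul_self,
          one_mul]
      by_cases hi : i = o <;> by_cases hj : j = o <;>
        simp [hi, hj, Quaternion.star_smul, smul_smul]
      simp only [hj] at h
      rw [h, one_smul]⟩, mem_m.2 (by simp)⟩
  map_add' v w := by
    refine m_ext fun i j hi => ?_
    by_cases hj : j = o <;> simp [hi, hj]
  map_smul' c w := by
    refine m_ext fun i j hi => ?_
    by_cases hj : j = o <;> simp [hi, hj]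

theorem col_apply (w : Fin p ⊕ Fin q → ℍ[ℝ]) (i j : Fin p ⊕ Fin q) :
    (col o w).1.1 i j = if i = o then (if j = o then 0 else
      -((sgn i * sgn j) • star (w j))) else if j = o then w i else 0 := rfl

theorem col_mem_P (w : Fin p ⊕ Fin q → ℍ[ℝ]) : (col o w).1 ∈ P o :=
  mem_P.2 fun i j h => by
    rw [col_apply]
    by_cases hi : i = o
    · simp [hi, h.1 hi]
    · simp [hi, mt h.2 hi]

theorem col_of_mem_P {z : m o} (hz : z.1 ∈ P o) : col o (fun i => z.1.1 i o) = z := by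
  refine m_ext fun i j hi => ?_
  rw [col_apply]
  by_cases hj : j = o
  · simp [hi, hj]
  · simp [hi, hj, mem_P.1 hz i j (by simp [hi, hj])]

/-! ### The subalgebra `𝔰𝔭(1)` of scalars -/

/-- The quaternion unit `i`. -/
def qI : ℍ[ℝ] := ⟨0, 1, 0, 0⟩

/-- The quaternion unit `j`. -/
def qJ : ℍ[ℝ] := ⟨0, 0, 1, 0⟩

/-- The quaternion unit `k`. -/
def qK : ℍ[ℝ] := ⟨0, 0, 0, 1⟩

@[simp] theorem re_qI : qI.re = 0 := rfl
@[simp] theorem imI_qI : qI.imI = 1 := rfl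
@[simp] theorem imJ_qI : qI.imJ = 0 := rfl
@[simp] theorem imK_qI : qI.imK = 0 := rfl
@[simp] theorem re_qJ : qJ.re = 0 := rfl
@[simp] theorem imI_qJ : qJ.imI = 0 := rfl
@[simp] theorem imJ_qJ : qJ.imJ = 1 := rfl
@[simp] theorem imK_qJ : qJ.imK = 0 := rfl
@[simp] theorem re_qK : qK.re = 0 := rfl
@[simp] theorem imI_qK : qK.imI = 0 := rfl
@[simp] theorem imJ_qK : qK.imJ = 0 := rfl
@[simp] theorem imK_qK : qK.imK = 1 := rfl

/-- Vanishing of the first cohomology of `𝔰𝔭(1)` with values in `ℍ` under commutators. -/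
theorem cocycle_commutator {f₁ f₂ f₃ h : ℍ[ℝ]}
    (h₃ : (2 : ℝ) • f₃ = f₁ * qJ - qJ * f₁ + (qI * f₂ - f₂ * qI))
    (h₁ : (2 : ℝ) • f₁ = f₂ * qK - qK * f₂ + (qJ * f₃ - f₃ * qJ))
    (h₂ : (2 : ℝ) • f₂ = f₃ * qI - qI * f₃ + (qK * f₁ - f₁ * qK))
    (hh : h = (1 / 8 : ℝ) •
      ((qI * f₁ - f₁ * qI) + (qJ * f₂ - f₂ * qJ) + (qK * f₃ - f₃ * qK))) :
    f₁ = h * qI - qI * h ∧ f₂ = h * qJ - qJ * h ∧ f₃ = h * qK - qK * h := by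
  subst hh
  simp only [Quaternion.ext_iff] at h₁ h₂ h₃ ⊢
  simp at h₁ h₂ h₃ ⊢
  refine ⟨⟨?_, ?_, ?_, ?_⟩, ⟨?_, ?_, ?_, ?_⟩, ⟨?_, ?_, ?_, ?_⟩⟩ <;> linarith

/-- Vanishing of the first cohomology of `𝔰𝔭(1)` with values in `ℍ` under left multiplication.
Two of the three cocycle relations suffice for this. -/
theorem cocycle_left_mul {f₁ f₂ f₃ h : ℍ[ℝ]}
    (h₁ : (2 : ℝ) • f₁ = qJ * f₃ - qK * f₂)
    (h₂ : (2 : ℝ) • f₂ = qK * f₁ - qI * f₃)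
    (hh : h = (1 / 3 : ℝ) • (qI * f₁ + qJ * f₂ + qK * f₃)) :
    f₁ = -(qI * h) ∧ f₂ = -(qJ * h) ∧ f₃ = -(qK * h) := by
  subst hh
  simp only [Quaternion.ext_iff] at h₁ h₂ ⊢
  simp at h₁ h₂ ⊢
  refine ⟨⟨?_, ?_, ?_, ?_⟩, ⟨?_, ?_, ?_, ?_⟩, ⟨?_, ?_, ?_, ?_⟩⟩ <;> linarith

/-- The element of `𝔤` which is `Im(r)` times the identity on the coordinates other than `o`.
These elements form a subalgebra isomorphic to `𝔰𝔭(1)`. -/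
noncomputable def scal (o : Fin p ⊕ Fin q) (r : ℍ[ℝ]) : m o := diagG o fun _ => r

theorem scal_mem (r : ℍ[ℝ]) : (scal o r).1 ∈ g o := diagG_mem _

@[simp] theorem im_qI : qI.im = qI := by ext <;> simp
@[simp] theorem im_qJ : qJ.im = qJ := by ext <;> simp
@[simp] theorem im_qK : qK.im = qK := by ext <;> simp

theorem adm_scal_apply (r : ℍ[ℝ]) (z : m o) {i j : Fin p ⊕ Fin q} (hi : i ≠ o) :
    (adm o (scal o r) z).1.1 i j = r.im * z.1.1 i j - z.1.1 i j * (if j = o then 0 else r.im) := by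
  rw [scal, adm_diagG_apply _ _ (by simp [hi]), if_neg hi]

theorem adm_apply_scal (r : ℍ[ℝ]) (z : m o) {i j : Fin p ⊕ Fin q} (hi : i ≠ o) :
    (adm o z (scal o r)).1.1 i j = z.1.1 i j * (if j = o then 0 else r.im) - r.im * z.1.1 i j := by
  rw [scal, adm_apply_diagG _ _ (by simp [hi]), if_neg hi]

theorem scal_apply (r : ℍ[ℝ]) (i j : Fin p ⊕ Fin q) :
    (scal o r).1.1 i j = if i = j then (if i = o then 0 else r.im) else 0 :=
  diagG_apply _ _ _

theorem adm_scal_scal {r s t : ℍ[ℝ]} (h : r.im * s.im - s.im * r.im = (2 : ℝ) • t.im) :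
    adm o (scal o r) (scal o s) = (2 : ℝ) • scal o t := by
  refine m_ext fun i j hi => ?_
  rw [adm_scal_apply _ _ hi]
  change _ = (2 : ℝ) • (scal o t).1.1 i j
  simp only [scal_apply]
  by_cases hij : i = j
  · subst hij; simp [hi, h]
  · simp [hij]

/-- On the subalgebra `𝔰𝔭(1)` of scalars, a derivation agrees with the product by an element
of `𝔪`. -/
theorem exists_eq_adm_on_scal {T : Module.End ℝ (m o)} (hT : T ∈ der o) :
    ∃ x ∈ g o, ∃ v ∈ P o, ∃ y : m o, y.1 = x + v ∧ ∀ r ∈ ({qI, qJ, qK} : Set ℍ[ℝ]),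
      T (scal o r) = adm o y (scal o r) := by
  have hT' : ∀ {r s t : ℍ[ℝ]}, r.im * s.im - s.im * r.im = (2 : ℝ) • t.im →
      ∀ i j, i ≠ o → (2 : ℝ) • (T (scal o t)).1.1 i j =
      (T (scal o r)).1.1 i j * (if j = o then 0 else s.im) - s.im * (T (scal o r)).1.1 i j +
      (r.im * (T (scal o s)).1.1 i j - (T (scal o s)).1.1 i j * (if j = o then 0 else r.im)) := by
    intro r s t h i j hi
    have h1 : T (adm o (scal o r) (scal o s)) =
      adm o (T (scal o r)) (scal o s) + adm o (scal o r) (T (scal o s)) := hT _ _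
    rw [adm_scal_scal h, map_smul] at h1
    have h2 := congrArg (fun z : m o => z.1.1 i j) h1
    change (2 : ℝ) • (T (scal o t)).1.1 i j = (adm o (T (scal o r)) (scal o s)).1.1 i j +
      (adm o (scal o r) (T (scal o s))).1.1 i j at h2
    rw [h2, adm_apply_scal _ _ hi, adm_scal_apply _ _ hi]
  have h3 := @hT' qI qJ qK (by ext <;> norm_num)
  have h1 := @hT' qJ qK qI (by ext <;> norm_num)
  have h2 := @hT' qK qI qJ (by ext <;> norm_num)
  -- The Casimir operator of `𝔰𝔭(1)` is `-8` on `Im ℍ` under commutators and `-3` on `ℍ` under left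
  -- multiplication. Hence the primitive is `Z / 8` on `𝔤` and `Z / 3` on `𝔭`.
  set Z : m o := adm o (scal o qI) (T (scal o qI)) + adm o (scal o qJ) (T (scal o qJ)) +
    adm o (scal o qK) (T (scal o qK)) with hZ
  have hZ' : ∀ i j, i ≠ o → Z.1.1 i j = _ := fun i j hi =>
    congrArg₂ (· + ·) (congrArg₂ (· + ·) (adm_scal_apply qI (T (scal o qI)) (j := j) hi)
      (adm_scal_apply qJ (T (scal o qJ)) (j := j) hi))
      (adm_scal_apply qK (T (scal o qK)) (j := j) hi)
  obtain ⟨x, hx, v, hv, hxv⟩ := Submodule.mem_sup.1 Z.2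
  have hx' : ∀ i j, i ≠ o → x.1 i j = if j = o then 0 else Z.1.1 i j := fun i j hi => by
    rw [← hxv]
    change _ = if j = o then 0 else x.1 i j + v.1 i j
    split_ifs with hj
    · rw [hj]; exact (mem_g.1 hx i).2
    · rw [mem_P.1 hv i j (by simp [hi, hj]), add_zero]
  have hv' : ∀ i j, i ≠ o → v.1 i j = if j = o then Z.1.1 i j else 0 := fun i j hi => by
    rw [← hxv]
    change _ = if j = o then x.1 i j + v.1 i j else 0
    split_ifs with hj
    · rw [hj, (mem_g.1 hx i).2, zero_add]
    · exact mem_P.1 hv i j (by simp [hi, hj])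
  have hx2 : (1 / 8 : ℝ) • x ∈ g o := (g o).smul_mem _ hx
  have hv2 : (1 / 3 : ℝ) • v ∈ P o := (P o).smul_mem _ hv
  refine ⟨_, hx2, _, hv2, ⟨_, Submodule.add_mem_sup hx2 hv2⟩, rfl, ?_⟩
  set y : m o := ⟨_, Submodule.add_mem_sup hx2 hv2⟩ with hy
  have hy' : ∀ i j, i ≠ o → y.1.1 i j = if j = o then (1 / 3 : ℝ) • Z.1.1 i j else
      (1 / 8 : ℝ) • Z.1.1 i j := fun i j hi => by
    change (1 / 8 : ℝ) • x.1 i j + (1 / 3 : ℝ) • v.1 i j = _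
    rw [hx' i j hi, hv' i j hi]
    split_ifs <;> simp
  have key : ∀ i j, i ≠ o →
      (T (scal o qI)).1.1 i j = (adm o y (scal o qI)).1.1 i j ∧
      (T (scal o qJ)).1.1 i j = (adm o y (scal o qJ)).1.1 i j ∧
      (T (scal o qK)).1.1 i j = (adm o y (scal o qK)).1.1 i j := by
    intro i j hi
    simp only [adm_apply_scal _ _ hi]
    have h1 := h1 i j hi
    have h2 := h2 i j hi
    have h3 := h3 i j hi
    have hy := hy' i j hi
    rw [hZ' i j hi] at hy
    by_cases hj : j = o
    · simp only [hj, if_true, im_qI, im_qJ, im_qK, mul_zero, sub_zero, zero_sub] at *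
      exact cocycle_left_mul (by rw [h1]; abel) (by rw [h2]; abel) hy
    · simp only [hj, if_false, im_qI, im_qJ, im_qK] at *
      exact cocycle_commutator h3 h1 h2 hy
  rintro r (rfl | rfl | rfl)
  · exact m_ext fun i j hi => (key i j hi).1
  · exact m_ext fun i j hi => (key i j hi).2.1
  · exact m_ext fun i j hi => (key i j hi).2.2

theorem scal_eq (r : ℍ[ℝ]) :
    scal o r = r.imI • scal o qI + r.imJ • scal o qJ + r.imK • scal o qK := by
  refine m_ext fun i j hi => ?_
  change _ = r.imI • (scal o qI).1.1 i j + r.imJ • (scal o qJ).1.1 i j +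
    r.imK • (scal o qK).1.1 i j
  simp only [scal_apply]
  by_cases hij : i = j
  · subst hij
    ext <;> simp [hi]
  · simp [hij]

/-- If `D` commutes with the scalars, it preserves `𝔭`: the element `i` acts on `𝔭` with square
`-1`, and on `𝔤` with the eigenvalues `0` and `±2i`. -/
theorem map_mem_P_of_comm_scal {D : Module.End ℝ (m o)}
    (hD : ∀ r z, D (adm o (scal o r) z) = adm o (scal o r) (D z)) {z : m o} (hz : z.1 ∈ P o) :
    (D z).1 ∈ P o := by
  have h1 : adm o (scal o qI) (adm o (scal o qI) z) = -z := by
    refine m_ext fun i j hi => ?_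
    change _ = -z.1.1 i j
    rw [adm_scal_apply _ _ hi, adm_scal_apply _ _ hi]
    by_cases hj : j = o
    · ext <;> simp [hj]
    · simp [hj, mem_P.1 hz i j (by simp [hi, hj])]
  have h2 : adm o (scal o qI) (adm o (scal o qI) (D z)) = -D z := by
    rw [← hD, ← hD, h1, map_neg]
  refine mem_P.2 fun i j hij => ?_
  by_cases hi : i = o
  · rw [hi, hij.1 hi, mem_m.1 (D z).2]
  · have hj : j ≠ o := mt hij.2 hi
    have h3 : (adm o (scal o qI) (adm o (scal o qI) (D z))).1.1 i j = -(D z).1.1 i j :=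
      congrArg (fun z : m o => z.1.1 i j) h2
    rw [adm_scal_apply _ _ hi, adm_scal_apply _ _ hi] at h3
    simp only [hj, if_false, im_qI, Quaternion.ext_iff] at h3
    simp at h3
    ext <;> simp <;> linarith

/-- If `D` commutes with the scalars, it preserves `𝔤`: the element `i` satisfies the equation
`t³ + 4t = 0` on `𝔤`, while `t³ + 4t` is invertible on `𝔭`. -/
theorem map_mem_g_of_comm_scal {D : Module.End ℝ (m o)}
    (hD : ∀ r z, D (adm o (scal o r) z) = adm o (scal o r) (D z)) {z : m o} (hz : z.1 ∈ g o) :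
    (D z).1 ∈ g o := by
  have h1 : adm o (scal o qI) (adm o (scal o qI) (adm o (scal o qI) z)) =
      -((4 : ℝ) • adm o (scal o qI) z) := by
    refine m_ext fun i j hi => ?_
    change _ = -((4 : ℝ) • (adm o (scal o qI) z).1.1 i j)
    rw [adm_scal_apply _ _ hi, adm_scal_apply _ _ hi, adm_scal_apply _ _ hi]
    by_cases hj : j = o
    · subst hj; simp [(mem_g.1 hz i).2]
    · ext <;> simp [hj] <;> ring
  have h2 : adm o (scal o qI) (adm o (scal o qI) (adm o (scal o qI) (D z))) =
      -((4 : ℝ) • adm o (scal o qI) (D z)) := by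
    rw [← hD, ← hD, ← hD, h1, map_neg, map_smul]
  have h4 : ∀ i, (D z).1.1 i o = 0 := fun i => by
    by_cases hi : i = o
    · rw [hi, mem_m.1 (D z).2]
    have h3 : (adm o (scal o qI) (adm o (scal o qI) (adm o (scal o qI) (D z)))).1.1 i o =
        -((4 : ℝ) • (adm o (scal o qI) (D z)).1.1 i o) :=
      congrArg (fun z : m o => z.1.1 i o) h2
    rw [adm_scal_apply _ _ hi, adm_scal_apply _ _ hi, adm_scal_apply _ _ hi] at h3
    simp only [if_true, im_qI, Quaternion.ext_iff] at h3
    simp at h3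
    ext <;> simp <;> linarith
  refine mem_g.2 fun i => ⟨?_, h4 i⟩
  rw [apply_eq, h4, star_zero, smul_zero, neg_zero]

/-! ### Products in terms of the `o`-th column -/

/-- Action of `𝔤 ⊕ 𝔨` on the `o`-th column. -/
theorem adm_apply_col {x : sp p q} (hx : x ∈ (g o).toSubmodule ⊔ (k o).toSubmodule) (z : m o)
    {b : Fin p ⊕ Fin q} (hb : b ≠ o) :
    (adm o x z).1.1 b o = ∑ c, x.1 b c * z.1.1 c o - z.1.1 b o * x.1 o o := by
  rw [adm_apply_apply _ _ (by simp [hb])]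
  congr 1
  refine Finset.sum_eq_single_of_mem o (Finset.mem_univ _) fun c _ hc => ?_
  rw [(apply_eq_zero_of_mem_sup hx hc).2, mul_zero]

theorem adm_g_apply_col {x : sp p q} (hx : x ∈ g o) (z : m o) {b : Fin p ⊕ Fin q} (hb : b ≠ o) :
    (adm o x z).1.1 b o = ∑ c, x.1 b c * z.1.1 c o := by
  rw [adm_apply_col (mem_sup_of_mem_g hx) z hb, (mem_g.1 hx o).1, mul_zero, sub_zero]

/-- The product of two elements of `𝔭`, in terms of their `o`-th columns. -/
theorem adm_P_P_apply {w u : m o} (hw : w.1 ∈ P o) (hu : u.1 ∈ P o) {i j : Fin p ⊕ Fin q}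
    (hi : i ≠ o) :
    (adm o w u).1.1 i j =
      -((sgn o * sgn j) • (w.1.1 i o * star (u.1.1 j o) - u.1.1 i o * star (w.1.1 j o))) := by
  rw [adm_apply_apply _ _ (by simp [hi])]
  rw [Finset.sum_eq_single_of_mem o (Finset.mem_univ _) fun c _ hc => by
      rw [mem_P.1 hw i c (by simp [hi, hc]), zero_mul],
    Finset.sum_eq_single_of_mem o (Finset.mem_univ _) fun c _ hc => by
      rw [mem_P.1 hu i c (by simp [hi, hc]), zero_mul],
    apply_eq u.1 o j, apply_eq w.1 o j]
  simp only [mul_neg, mul_smul_comm, smul_sub]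
  abel

theorem adm_mem_P {x : sp p q} (hx : x ∈ (g o).toSubmodule ⊔ (k o).toSubmodule) {z : m o}
    (hz : z.1 ∈ P o) : (adm o x z).1 ∈ P o := by
  refine mem_P.2 fun i j hij => ?_
  by_cases hi : i = o
  · rw [hi, hij.1 hi, mem_m.1 (adm o x z).2]
  · have hj : j ≠ o := mt hij.2 hi
    rw [adm_apply_apply _ _ (by simp [hi]), Finset.sum_eq_zero, Finset.sum_eq_zero, sub_zero]
    · intro c _
      by_cases hc : c = o
      · rw [hc, (apply_eq_zero_of_mem_sup hx hj).1, mul_zero]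
      · rw [mem_P.1 hz i c (by simp [hi, hc]), zero_mul]
    · intro c _
      by_cases hc : c = o
      · rw [hc, (apply_eq_zero_of_mem_sup hx hi).2, zero_mul]
      · rw [mem_P.1 hz c j (by simp [hj, hc]), mul_zero]

theorem mem_g_of_col_eq_zero {z : m o} (h : ∀ i, i ≠ o → z.1.1 i o = 0) : z.1 ∈ g o := by
  have h' : ∀ i, z.1.1 i o = 0 := fun i => by
    by_cases hi : i = o
    · rw [hi, mem_m.1 z.2]
    · exact h i hi
  refine mem_g.2 fun i => ⟨?_, h' i⟩
  rw [apply_eq, h', star_zero, smul_zero, neg_zero]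

theorem adm_mem_g {x : sp p q} (hx : x ∈ (g o).toSubmodule ⊔ (k o).toSubmodule) {z : m o}
    (hz : z.1 ∈ g o) : (adm o x z).1 ∈ g o := by
  refine mem_g_of_col_eq_zero fun i hi => ?_
  rw [adm_apply_col hx z hi, (mem_g.1 hz i).2, zero_mul, sub_zero]
  exact Finset.sum_eq_zero fun c _ => by rw [(mem_g.1 hz c).2, mul_zero]

theorem adm_P_P_mem {w u : m o} (hw : w.1 ∈ P o) (hu : u.1 ∈ P o) : (adm o w u).1 ∈ g o := by
  refine mem_g_of_col_eq_zero fun i hi => ?_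
  rw [adm_apply_apply _ _ (by simp [hi]), Finset.sum_eq_zero, Finset.sum_eq_zero, sub_zero]
  · intro c _
    by_cases hc : c = o
    · rw [hc, mem_P.1 hw o o Iff.rfl, mul_zero]
    · rw [mem_P.1 hu i c (by simp [hi, hc]), zero_mul]
  · intro c _
    by_cases hc : c = o
    · rw [hc, mem_P.1 hu o o Iff.rfl, mul_zero]
    · rw [mem_P.1 hw i c (by simp [hi, hc]), zero_mul]

theorem col_apply_col (w : Fin p ⊕ Fin q → ℍ[ℝ]) {i : Fin p ⊕ Fin q} (hi : i ≠ o) :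
    (col o w).1.1 i o = w i := by simp [col_apply, hi]

/-- Two elements of `𝔭` with the same `o`-th column are equal. -/
theorem P_ext {y z : m o} (hy : y.1 ∈ P o) (hz : z.1 ∈ P o)
    (h : ∀ i, i ≠ o → y.1.1 i o = z.1.1 i o) : y = z := by
  refine m_ext fun i j hi => ?_
  by_cases hj : j = o
  · rw [hj, h i hi]
  · rw [mem_P.1 hy i j (by simp [hi, hj]), mem_P.1 hz i j (by simp [hi, hj])]

/-- The quaternionic multiples of a basis vector of `𝔭` are obtained from it by the action of the
scalars. -/
theorem col_single_eq (a : Fin p ⊕ Fin q) (r : ℍ[ℝ]) :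
    col o (Pi.single a r) =
      r.re • col o (Pi.single a 1) + adm o (scal o r) (col o (Pi.single a 1)) := by
  refine P_ext (col_mem_P _)
    ((P o).add_mem ((P o).smul_mem _ (col_mem_P _))
      (adm_mem_P (mem_sup_of_mem_g (scal_mem r)) (col_mem_P _)))
    fun i hi => ?_
  change _ = r.re • (col o (Pi.single a 1)).1.1 i o +
    (adm o (scal o r) (col o (Pi.single a 1))).1.1 i o
  rw [adm_scal_apply _ _ hi]
  simp only [col_apply_col _ hi]
  by_cases h : i = a
  · subst h
    ext <;> simp
  · simp [h]

/-- The endomorphisms of `𝔪` which kill the scalars and satisfy the Leibniz rule for products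
with one factor in `𝔤`. -/
structure IsRelDer (D : Module.End ℝ (m o)) : Prop where
  map_scal : ∀ r, D (scal o r) = 0
  leibniz : ∀ a : m o, a.1 ∈ g o → ∀ z, D (adm o a z) = adm o (D a) z + adm o a (D z)

/-- The matrix of `D` on `𝔭 ≅ ℍⁿ⁻¹` in the standard basis, as a left `ℍ`-linear map acting from the
right: `D` maps the column `w` to the column with entries `∑ a, w a * φ b a`. -/
noncomputable def phi (D : Module.End ℝ (m o)) (b a : Fin p ⊕ Fin q) : ℍ[ℝ] :=
  (D (col o (Pi.single a 1))).1.1 b o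

namespace IsRelDer
variable {D : Module.End ℝ (m o)}

theorem comm_scal (hD : IsRelDer D) (r : ℍ[ℝ]) (z : m o) :
    D (adm o (scal o r) z) = adm o (scal o r) (D z) := by
  rw [hD.leibniz _ (scal_mem r), hD.map_scal]
  simp

end IsRelDer

/-! ### The matrix of a relative derivation on `𝔭` -/

theorem col_single_self (r : ℍ[ℝ]) : col o (Pi.single o r) = 0 := by
  refine P_ext (col_mem_P _) (P o).zero_mem fun i hi => ?_
  rw [col_apply_col _ hi, Pi.single_eq_of_ne hi]
  rfl

theorem sgn_mul_sgn_ne_zero (i j : Fin p ⊕ Fin q) : sgn i * sgn j ≠ 0 := by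
  cases i <;> cases j <;> simp [sgn]

/-- An element of `𝔤` is determined by its action on `𝔭`. -/
theorem eq_zero_of_adm_P {x : m o} (hx : x.1 ∈ g o) (h : ∀ z : m o, z.1 ∈ P o → adm o x z = 0) :
    x = 0 := by
  refine m_ext fun i j hi => ?_
  by_cases hj : j = o
  · subst hj; exact (mem_g.1 hx i).2
  have h1 : (adm o x (col o (Pi.single j 1))).1.1 i o = 0 := by
    rw [h _ (col_mem_P _)]; rfl
  rw [adm_g_apply_col hx _ hi, Finset.sum_eq_single_of_mem j (Finset.mem_univ _),
    col_apply_col _ hj, Pi.single_eq_same, mul_one] at h1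
  · exact h1
  · intro c _ hc
    by_cases hco : c = o
    · rw [hco, (mem_g.1 hx i).2, zero_mul]
    · rw [col_apply_col _ hco, Pi.single_eq_of_ne hc, mul_zero]

/-- If right multiplication by `s` is right `ℍ`-linear, then `s` is real. -/
theorem eq_coe_re_of_mul_eq {A s : ℍ[ℝ]} (h : ∀ r, A * r = r * s) : s = (s.re : ℍ[ℝ]) := by
  have h0 : A = s := by simpa using h 1
  have h1 := h qI
  have h2 := h qJ
  subst h0
  simp only [Quaternion.ext_iff] at h1 h2 ⊢
  simp at h1 h2 ⊢
  exact ⟨by linarith [h2.2], by linarith [h1.2], by linarith [h1.1]⟩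

namespace IsRelDer
variable {D : Module.End ℝ (m o)}

theorem map_mem_g (hD : IsRelDer D) {z : m o} (hz : z.1 ∈ g o) : (D z).1 ∈ g o :=
  map_mem_g_of_comm_scal hD.comm_scal hz

theorem map_mem_P (hD : IsRelDer D) {z : m o} (hz : z.1 ∈ P o) : (D z).1 ∈ P o :=
  map_mem_P_of_comm_scal hD.comm_scal hz

theorem map_col_single (hD : IsRelDer D) {b : Fin p ⊕ Fin q} (hb : b ≠ o) (a : Fin p ⊕ Fin q)
    (r : ℍ[ℝ]) : (D (col o (Pi.single a r))).1.1 b o = r * phi D b a := by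
  rw [col_single_eq, map_add, map_smul, hD.comm_scal]
  change r.re • (D (col o (Pi.single a 1))).1.1 b o +
    (adm o (scal o r) (D (col o (Pi.single a 1)))).1.1 b o = _
  rw [adm_scal_apply _ _ hb, if_pos rfl, mul_zero, sub_zero, ← Quaternion.coe_mul_eq_smul,
    ← add_mul, Quaternion.re_add_im]
  rfl

theorem map_P (hD : IsRelDer D) {b : Fin p ⊕ Fin q} (hb : b ≠ o) {z : m o} (hz : z.1 ∈ P o) :
    (D z).1.1 b o = ∑ a, z.1.1 a o * phi D b a := by
  rw [← col_of_mem_P hz]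
  generalize (fun i => z.1.1 i o) = w
  let ev : m o →ₗ[ℝ] ℍ[ℝ] :=
    { toFun := fun y => y.1.1 b o, map_add' := fun _ _ => rfl, map_smul' := fun _ _ => rfl }
  have h : w = ∑ a, Pi.single a (w a) := (Finset.univ_sum_single w).symm
  change ev (D (col o w)) = _
  conv_lhs => rw [h]
  rw [map_sum, map_sum, map_sum]
  refine Finset.sum_congr rfl fun a _ => ?_
  by_cases ha : a = o
  · subst ha
    rw [col_single_self, mem_P.1 (col_mem_P w) a a Iff.rfl]
    simp
  · rw [col_apply_col _ ha]
    exact hD.map_col_single hb a (w a)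

/-- The Leibniz rule for `a ∈ 𝔤` and an element of `𝔭` with one nonzero entry in its column. -/
theorem leibniz_col (hD : IsRelDer D) {a : m o} (ha : a.1 ∈ g o) {b d : Fin p ⊕ Fin q}
    (hb : b ≠ o) (r : ℍ[ℝ]) :
    (D (adm o a (col o (Pi.single d r)))).1.1 b o =
      (D a).1.1 b d * r + ∑ c, a.1.1 b c * (r * phi D c d) := by
  rw [hD.leibniz a ha]
  change (adm o (D a) _).1.1 b o + (adm o a _).1.1 b o = _
  rw [adm_g_apply_col (hD.map_mem_g ha) _ hb, adm_g_apply_col ha _ hb]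
  congr 1
  · rw [Finset.sum_eq_single_of_mem d (Finset.mem_univ _)]
    · by_cases hd : d = o
      · subst hd
        rw [(mem_g.1 (hD.map_mem_g ha) b).2, zero_mul, zero_mul]
      · rw [col_apply_col _ hd, Pi.single_eq_same]
    · intro c _ hc
      by_cases hco : c = o
      · rw [hco, (mem_g.1 (hD.map_mem_g ha) b).2, zero_mul]
      · rw [col_apply_col _ hco, Pi.single_eq_of_ne hc, mul_zero]
  · refine Finset.sum_congr rfl fun c _ => ?_
    by_cases hco : c = o
    · rw [hco, (mem_g.1 ha b).2, zero_mul, zero_mul]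
    · rw [hD.map_col_single hco]

theorem adm_diagG_single_col (c d : Fin p ⊕ Fin q) (s r : ℍ[ℝ]) :
    adm o (diagG o (Pi.single c s)) (col o (Pi.single d r)) =
      col o (if c = d then Pi.single d (s.im * r) else 0) := by
  refine P_ext (adm_mem_P (mem_sup_of_mem_g (diagG_mem _)) (col_mem_P _)) (col_mem_P _)
    fun i hi => ?_
  rw [adm_diagG_apply _ _ (by simp [hi]), col_apply_col _ hi, col_apply_col _ hi]
  rw [if_neg hi, if_pos rfl, mul_zero, sub_zero]
  by_cases hcd : c = d
  · subst hcd
    by_cases hic : i = c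
    · subst hic; simp
    · simp [hic]
  · by_cases hic : i = c
    · subst hic; simp [hcd]
    · simp [hic, hcd]

/-- The Leibniz rule for the elements of `𝔤` with one nonzero diagonal entry. -/
theorem leibniz_diagG_single (hD : IsRelDer D) {b : Fin p ⊕ Fin q} (hb : b ≠ o)
    (c d : Fin p ⊕ Fin q) (s r : ℍ[ℝ]) :
    (if c = d then s.im * r * phi D b d else 0) =
      (D (diagG o (Pi.single c s))).1.1 b d * r + if b = c then s.im * (r * phi D b d) else 0 := by
  have h := hD.leibniz_col (diagG_mem (Pi.single c s)) (d := d) hb r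
  rw [adm_diagG_single_col] at h
  have h1 : (D (col o (if c = d then Pi.single d (s.im * r) else 0))).1.1 b o =
      if c = d then s.im * r * phi D b d else 0 := by
    split_ifs
    · exact hD.map_col_single hb _ _
    · rw [map_zero, map_zero]; rfl
  rw [← h1, h]
  congr 1
  rw [Finset.sum_eq_single_of_mem b (Finset.mem_univ _)]
  · rw [diagG_apply, if_pos rfl, if_neg hb]
    split_ifs with hbc
    · rw [hbc, Pi.single_eq_same]
    · rw [Pi.single_eq_of_ne hbc, Quaternion.im_zero, zero_mul]
  · intro e _ he
    rw [diagG_apply, if_neg (Ne.symm he), zero_mul]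

/-- The off-diagonal entries are real, because `D` maps the diagonal elements of `𝔤` to matrices,
which act on `𝔭` right `ℍ`-linearly. -/
theorem phi_real (hD : IsRelDer D) {b c : Fin p ⊕ Fin q} (hb : b ≠ o) (hbc : b ≠ c) :
    phi D b c = ((phi D b c).re : ℍ[ℝ]) := by
  refine eq_coe_re_of_mul_eq (A := -(qI * (D (diagG o (Pi.single c qI))).1.1 b c)) fun r => ?_
  have h := hD.leibniz_diagG_single hb c c qI r
  rw [if_pos rfl, if_neg hbc, add_zero, im_qI] at h
  have hI : qI * qI = -1 := by ext <;> simp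
  rw [neg_mul, mul_assoc, ← h, ← mul_assoc, ← mul_assoc, hI]
  simp

/-- The off-diagonal part is skew for the form, because `D` maps the diagonal elements of `𝔤` to
elements of `𝔰𝔭(p,q)`. -/
theorem phi_skew (hD : IsRelDer D) {b c : Fin p ⊕ Fin q} (hb : b ≠ o) (hc : c ≠ o) (hbc : b ≠ c) :
    phi D b c = -((sgn b * sgn c) • phi D c b) := by
  have h1 := hD.leibniz_diagG_single hb c c qI 1
  have h2 := hD.leibniz_diagG_single hc c b qI 1
  have h3 := apply_eq (D (diagG o (Pi.single c qI))).1 b c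
  rw [if_pos rfl, if_neg hbc, add_zero, im_qI, mul_one, mul_one] at h1
  rw [if_neg (Ne.symm hbc), if_pos rfl, im_qI, mul_one, one_mul] at h2
  rw [← h1, ← neg_eq_of_add_eq_zero_left h2.symm, hD.phi_real hb hbc,
    hD.phi_real hc (Ne.symm hbc)] at h3
  rw [hD.phi_real hb hbc, hD.phi_real hc (Ne.symm hbc)]
  have h4 := congrArg QuaternionAlgebra.imI h3
  ext <;> simp at h4 ⊢
  linarith

/-- The element of `𝔤` with entry `1` at `(c,d)`, whose entries other than those at `(c,d)` and
`(d,c)` vanish. -/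
noncomputable def rot {c d : Fin p ⊕ Fin q} (hc : c ≠ o) (hcd : c ≠ d) : m o :=
  ⟨⟨Matrix.of fun i j => if i = c ∧ j = d then 1 else
      if i = d ∧ j = c then -((sgn c * sgn d : ℝ) : ℍ[ℝ]) else 0, by
    refine mem_sp_iff_apply_eq.2 fun i j => ?_
    have h1 := sgn_mul_self c
    have h2 := sgn_mul_self d
    simp only [Matrix.of_apply]
    by_cases h : i = c ∧ j = d
    · obtain ⟨rfl, rfl⟩ := h
      have h3 : sgn i * sgn j * (sgn i * sgn j) = 1 := by
        rw [mul_mul_mul_comm, h1, h2, one_mul]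
      rw [if_pos ⟨rfl, rfl⟩, if_neg (fun h => hcd h.1.symm), if_pos ⟨rfl, rfl⟩, star_neg,
        smul_neg, neg_neg, Quaternion.star_coe, ← Quaternion.coe_mul_eq_smul,
        ← Quaternion.coe_mul, h3, Quaternion.coe_one]
    · by_cases h' : i = d ∧ j = c
      · obtain ⟨rfl, rfl⟩ := h'
        rw [if_neg h, if_pos ⟨rfl, rfl⟩, if_pos ⟨rfl, rfl⟩, star_one,
          ← Quaternion.coe_mul_eq_smul, mul_one, mul_comm]
      · rw [if_neg h, if_neg h', if_neg (fun h => h' ⟨h.2, h.1⟩),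
          if_neg (fun h'' => h ⟨h''.2, h''.1⟩), star_zero, smul_zero, neg_zero]⟩,
    mem_m.2 (by simp [Ne.symm hc])⟩

theorem rot_apply {c d : Fin p ⊕ Fin q} (hc : c ≠ o) (hcd : c ≠ d) (i j : Fin p ⊕ Fin q) :
    (rot hc hcd).1.1 i j = if i = c ∧ j = d then 1 else
      if i = d ∧ j = c then -((sgn c * sgn d : ℝ) : ℍ[ℝ]) else 0 := rfl

theorem rot_mem {c d : Fin p ⊕ Fin q} (hc : c ≠ o) (hd : d ≠ o) (hcd : c ≠ d) :
    (rot hc hcd).1 ∈ g o :=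
  mem_g.2 fun i => by simp [rot_apply, Ne.symm hc, Ne.symm hd]

theorem adm_rot_col {c d : Fin p ⊕ Fin q} (hc : c ≠ o) (hd : d ≠ o) (hcd : c ≠ d) (r : ℍ[ℝ]) :
    adm o (rot hc hcd) (col o (Pi.single d r)) = col o (Pi.single c r) := by
  refine P_ext (adm_mem_P (mem_sup_of_mem_g (rot_mem hc hd hcd)) (col_mem_P _)) (col_mem_P _)
    fun i hi => ?_
  rw [adm_g_apply_col (rot_mem hc hd hcd) _ hi, col_apply_col _ hi,
    Finset.sum_eq_single_of_mem d (Finset.mem_univ _), col_apply_col _ hd, Pi.single_eq_same]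
  · by_cases hic : i = c
    · subst hic; simp [rot_apply]
    · simp [rot_apply, hic, Ne.symm hcd]
  · intro e _ he
    by_cases heo : e = o
    · rw [heo, (mem_g.1 (rot_mem hc hd hcd) i).2, zero_mul]
    · rw [col_apply_col _ heo, Pi.single_eq_of_ne he, mul_zero]

/-- The diagonal entries differ by real numbers, because `D (rot hc hcd)` acts on `𝔭` right
`ℍ`-linearly. -/
theorem phi_self_sub (hD : IsRelDer D) {c d : Fin p ⊕ Fin q} (hc : c ≠ o) (hd : d ≠ o)
    (hcd : c ≠ d) : phi D c c - phi D d d = ((phi D c c - phi D d d).re : ℍ[ℝ]) := by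
  refine eq_coe_re_of_mul_eq (A := (D (rot hc hcd)).1.1 c d) fun r => ?_
  have h := hD.leibniz_col (rot_mem hc hd hcd) (d := d) hc r
  rw [adm_rot_col hc hd hcd, hD.map_col_single hc,
    Finset.sum_eq_single_of_mem d (Finset.mem_univ _)] at h
  · rw [rot_apply, if_pos ⟨rfl, rfl⟩, one_mul] at h
    rw [mul_sub, h, add_sub_cancel_right]
  · intro e _ he
    rw [rot_apply, if_neg (fun h => he h.2), if_neg (fun h => hcd h.1), zero_mul]

/-- The Leibniz rule on `𝔭`, up to a component in `𝔭`, makes the diagonal of `phi D` imaginary. -/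
theorem re_phi_self (hD : IsRelDer D)
    (hP : ∀ w u : m o, w.1 ∈ P o → u.1 ∈ P o → ∀ i j, i ≠ o → j ≠ o →
      (D (adm o w u)).1.1 i j = (adm o (D w) u).1.1 i j + (adm o w (D u)).1.1 i j)
    {a : Fin p ⊕ Fin q} (ha : a ≠ o) : (phi D a a).re = 0 := by
  set w := col o (Pi.single a qI)
  set u := col o (Pi.single a 1)
  have hw : w.1 ∈ P o := col_mem_P _
  have hu : u.1 ∈ P o := col_mem_P _
  have h0 : adm o w u = (-(2 * (sgn o * sgn a))) • diagG o (Pi.single a qI) := by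
    refine m_ext fun i j hi => ?_
    change _ = (-(2 * (sgn o * sgn a))) • (diagG o (Pi.single a qI)).1.1 i j
    by_cases hj : j = o
    · subst hj
      rw [(mem_g.1 (adm_P_P_mem hw hu) i).2, (mem_g.1 (diagG_mem _) i).2, smul_zero]
    rw [adm_P_P_apply hw hu hi, diagG_apply, col_apply_col _ hi, col_apply_col _ hj,
      col_apply_col _ hi, col_apply_col _ hj]
    by_cases hia : i = a
    · subst hia
      by_cases hji : j = i
      · subst hji
        ext <;> simp [hi]
        ring
      · simp [hji, Ne.symm hji]
    · by_cases hij : i = j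
      · subst hij; simp [hia]
      · simp [hia, hij]
  have h1 : (D (diagG o (Pi.single a qI))).1.1 a a = 0 := by
    have h := hD.leibniz_diagG_single ha a a qI 1
    rw [if_pos rfl, if_pos rfl, mul_one, mul_one, one_mul] at h
    exact left_eq_add.1 ((add_comm _ _).trans h.symm).symm
  have h2 := hP w u hw hu a a ha ha
  have h3 : (D ((-(2 * (sgn o * sgn a))) • diagG o (Pi.single a qI))).1.1 a a = 0 := by
    rw [map_smul]
    change (-(2 * (sgn o * sgn a))) • (D (diagG o (Pi.single a qI))).1.1 a a = 0
    rw [h1, smul_zero]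
  rw [h0, h3, adm_P_P_apply (hD.map_mem_P hw) hu ha, adm_P_P_apply hw (hD.map_mem_P hu) ha,
    hD.map_col_single ha, hD.map_col_single ha, col_apply_col _ ha, col_apply_col _ ha,
    ← neg_add, ← smul_add, zero_eq_neg, smul_eq_zero, or_iff_right (sgn_mul_sgn_ne_zero o a)] at h2
  have h4 := congrArg QuaternionAlgebra.imI h2
  simp at h4
  linarith

/-- The element of `𝔤` with the off-diagonal entries of `phi D`. -/
theorem exists_mem_g (hD : IsRelDer D) : ∃ M ∈ g o, ∀ i j, i ≠ o → j ≠ o →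
    M.1 i j = if i = j then 0 else phi D i j := by
  refine ⟨⟨Matrix.of fun i j => if i = o ∨ j = o ∨ i = j then 0 else phi D i j, ?_⟩,
    mem_g.2 fun i => by simp, fun i j hi hj => by simp [hi, hj]⟩
  refine mem_sp_iff_apply_eq.2 fun i j => ?_
  by_cases hi : i = o
  · simp [hi]
  by_cases hj : j = o
  · simp [hj]
  by_cases hij : i = j
  · simp [hij]
  · simp only [Matrix.of_apply, hi, hj, hij, Ne.symm hij, false_or, if_false]
    rw [hD.phi_skew hi hj hij]
    congr 2
    rw [hD.phi_real hj (Ne.symm hij), Quaternion.star_coe]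

theorem exists_phi_self (hD : IsRelDer D) (h0 : ∀ a, a ≠ o → (phi D a a).re = 0) :
    ∃ s : ℍ[ℝ], s.re = 0 ∧ ∀ a, a ≠ o → phi D a a = s := by
  by_cases h : ∃ a, a ≠ o
  · obtain ⟨a, ha⟩ := h
    refine ⟨phi D a a, h0 a ha, fun b hb => ?_⟩
    by_cases hab : b = a
    · rw [hab]
    · have h1 := hD.phi_self_sub hb ha hab
      rwa [Quaternion.re_sub, h0 a ha, h0 b hb, sub_zero, Quaternion.coe_zero, sub_eq_zero] at h1
  · exact ⟨0, rfl, fun a ha => (h ⟨a, ha⟩).elim⟩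

/-- The action of `D` is that of an element `M + κ` of `𝔤 ⊕ 𝔨`, with `M` the off-diagonal part
of `phi D` and `-κ` the common value of its diagonal entries. -/
theorem exists_eq_adm (hD : IsRelDer D)
    (hP : ∀ w u : m o, w.1 ∈ P o → u.1 ∈ P o → ∀ i j, i ≠ o → j ≠ o →
      (D (adm o w u)).1.1 i j = (adm o (D w) u).1.1 i j + (adm o w (D u)).1.1 i j) :
    ∃ x ∈ (g o).toSubmodule ⊔ (k o).toSubmodule, D = adm o x := by
  obtain ⟨M, hM, hM'⟩ := hD.exists_mem_g
  obtain ⟨s, hs, hs'⟩ := hD.exists_phi_self fun a ha => hD.re_phi_self hP ha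
  let κ : sp p q := ⟨Matrix.of fun i j => if i = o ∧ j = o then -s else 0,
    mem_sp_iff_apply_eq.2 fun i j => by
      by_cases h : i = o ∧ j = o
      · obtain ⟨rfl, rfl⟩ := h
        ext <;> simp [sgn_mul_self, hs]
      · have h' : ¬ (j = o ∧ i = o) := fun h' => h ⟨h'.2, h'.1⟩
        simp [h, h']⟩
  have hκ : ∀ i j, κ.1 i j = if i = o ∧ j = o then -s else 0 := fun _ _ => rfl
  have hκ' : κ ∈ k o := mem_k.2 fun i j h => by rw [hκ, if_neg h]
  have hx : M + κ ∈ (g o).toSubmodule ⊔ (k o).toSubmodule := Submodule.add_mem_sup hM hκ'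
  have hadd : ∀ i j, (M + κ).1 i j = M.1 i j + κ.1 i j := fun _ _ => rfl
  refine ⟨M + κ, hx, ?_⟩
  have hP' : ∀ z : m o, z.1 ∈ P o → D z = adm o (M + κ) z := by
    intro z hz
    refine P_ext (hD.map_mem_P hz) (adm_mem_P hx hz) fun b hb => ?_
    rw [hD.map_P hb hz, adm_apply_col hx z hb]
    have h1 : (M + κ).1 o o = -s := by
      rw [hadd, (mem_g.1 hM o).1, hκ, if_pos ⟨rfl, rfl⟩, zero_add]
    have h2 : z.1.1 b o * s = ∑ a, if a = b then z.1.1 b o * s else 0 := by simp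
    rw [h1, mul_neg, sub_neg_eq_add, h2, ← Finset.sum_add_distrib]
    refine Finset.sum_congr rfl fun a _ => ?_
    by_cases ha : a = o
    · rw [ha, mem_P.1 hz o o Iff.rfl, if_neg (Ne.symm hb)]; simp
    rw [hadd, hκ, if_neg (fun h => hb h.1), add_zero, hM' b a hb ha]
    by_cases hab : a = b
    · subst hab; simp [hs' a ha]
    · rw [if_neg (Ne.symm hab), if_neg hab, add_zero, hD.phi_real hb (Ne.symm hab)]
      exact (Quaternion.coe_commutes _ _).symm
  have hG' : ∀ a : m o, a.1 ∈ g o → D a = adm o (M + κ) a := by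
    intro a ha
    refine sub_eq_zero.1 (eq_zero_of_adm_P
      ((g o).sub_mem (hD.map_mem_g ha) (adm_mem_g hx ha)) fun z hz => ?_)
    have h1 := hD.leibniz a ha z
    have h2 : adm o (M + κ) (adm o a z) =
      adm o (adm o (M + κ) a : m o) z + adm o a (adm o (M + κ) z) := adm_mem_der hx a z
    rw [hP' _ (adm_mem_P (mem_sup_of_mem_g ha) hz), hP' z hz, h2] at h1
    rw [Submodule.coe_sub, map_sub, LinearMap.sub_apply, sub_eq_zero]
    exact (add_right_cancel h1).symm
  refine LinearMap.ext fun z => ?_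
  obtain ⟨a, ha, b, hb, hab⟩ := Submodule.mem_sup.1 z.2
  have hz : z = ⟨a, Submodule.mem_sup_left ha⟩ + ⟨b, Submodule.mem_sup_right hb⟩ :=
    Subtype.ext hab.symm
  rw [hz, map_add, map_add, hG' _ ha, hP' _ hb]

end IsRelDer

/-! ### Derivations of `𝔪` -/

/-- For `v ∈ 𝔭`, the map `y ↦ [v,y]_𝔪` is not a derivation unless `v = 0`. It suffices to test it
on pairs of elements of `𝔭` whose columns are `i`, `j`, `k` times the same basis vector. -/
theorem eq_zero_of_adm_mem_der {v : m o} (hv : v.1 ∈ P o) (h : adm o v ∈ der o) : v = 0 := by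
  refine P_ext hv (P o).zero_mem fun a ha => ?_
  have key : ∀ r s : ℍ[ℝ], (r * star s - s * star r) * v.1.1 a o =
      -((v.1.1 a o * star r - r * star (v.1.1 a o)) * s) +
        (v.1.1 a o * star s - s * star (v.1.1 a o)) * r := by
    intro r s
    have hcol : ∀ (x : m o) (t : ℍ[ℝ]), x.1 ∈ g o →
        (adm o x (col o (Pi.single a t))).1.1 a o = x.1.1 a a * t := by
      intro x t hx
      rw [adm_g_apply_col hx _ ha, Finset.sum_eq_single_of_mem a (Finset.mem_univ _),
        col_apply_col _ ha, Pi.single_eq_same]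
      intro c _ hc
      by_cases hco : c = o
      · rw [hco, (mem_g.1 hx a).2, zero_mul]
      · rw [col_apply_col _ hco, Pi.single_eq_of_ne hc, mul_zero]
    set w := col o (Pi.single a r) with hw
    set u := col o (Pi.single a s) with hu
    have hwP : w.1 ∈ P o := col_mem_P _
    have huP : u.1 ∈ P o := col_mem_P _
    have h1 : adm o v (adm o w u) = adm o (adm o v w : m o) u + adm o w (adm o v u) := h w u
    rw [adm_swap v, adm_swap w (adm o v u)] at h1
    have h2 : -(adm o (adm o w u : m o) v).1.1 a o =
        (adm o (adm o v w : m o) u).1.1 a o + -(adm o (adm o v u : m o) w).1.1 a o :=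
      congrArg (fun z : m o => z.1.1 a o) h1
    have hwa : w.1.1 a o = r := by rw [hw, col_apply_col _ ha, Pi.single_eq_same]
    have hua : u.1.1 a o = s := by rw [hu, col_apply_col _ ha, Pi.single_eq_same]
    rw [hcol _ _ (adm_P_P_mem hv hwP), hcol _ _ (adm_P_P_mem hv huP),
      adm_g_apply_col (adm_P_P_mem hwP huP) _ ha,
      Finset.sum_eq_single_of_mem a (Finset.mem_univ _), adm_P_P_apply hwP huP ha,
      adm_P_P_apply hv hwP ha, adm_P_P_apply hv huP ha, hwa, hua] at h2
    · refine smul_right_injective ℍ[ℝ] (sgn_mul_sgn_ne_zero o a) ?_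
      simpa only [neg_mul, neg_neg, smul_mul_assoc, smul_add, smul_neg] using h2
    · intro c _ hc
      by_cases hco : c = o
      · rw [hco, (mem_g.1 (adm_P_P_mem hwP huP) a).2, zero_mul]
      · rw [adm_P_P_apply hwP huP ha, hw, hu, col_apply_col _ hco, col_apply_col _ hco,
          Pi.single_eq_of_ne hc, Pi.single_eq_of_ne hc]
        simp
  have h1 := key qI qJ
  have h2 := key qJ qK
  have h3 := key qK qI
  change v.1.1 a o = 0
  simp only [Quaternion.ext_iff] at h1 h2 h3 ⊢
  simp at h1 h2 h3 ⊢
  refine ⟨?_, ?_, ?_, ?_⟩ <;> linarith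

/-- For a derivation `S` and `v ∈ 𝔭`, the map `y ↦ S y - [v,y]_𝔪` satisfies the Leibniz rule on
`𝔭` up to a component in `𝔭`, because `y ↦ [v,y]_𝔪` exchanges `𝔤` and `𝔭` up to that component. -/
theorem sub_adm_leibniz_P {S : Module.End ℝ (m o)} (hS : S ∈ der o) {v w u : m o}
    (hv : v.1 ∈ P o) (hw : w.1 ∈ P o) (hu : u.1 ∈ P o) {i j : Fin p ⊕ Fin q} (hi : i ≠ o)
    (hj : j ≠ o) :
    ((S - adm o v) (adm o w u)).1.1 i j =
      (adm o ((S - adm o v) w : m o) u).1.1 i j + (adm o w ((S - adm o v) u)).1.1 i j := by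
  have hij : i = o ↔ j = o := by simp [hi, hj]
  have h3 : (adm o v (adm o w u)).1.1 i j = 0 := by
    rw [adm_swap]
    exact mem_P.1
      ((P o).neg_mem (adm_mem_P (mem_sup_of_mem_g (adm_P_P_mem hw hu)) hv)) i j hij
  have h4 : (adm o (adm o v w : m o) u).1.1 i j = 0 :=
    mem_P.1 (adm_mem_P (mem_sup_of_mem_g (adm_P_P_mem hv hw)) hu) i j hij
  have h5 : (adm o w (adm o v u)).1.1 i j = 0 := by
    rw [adm_swap]
    exact mem_P.1
      ((P o).neg_mem (adm_mem_P (mem_sup_of_mem_g (adm_P_P_mem hv hu)) hw)) i j hij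
  have h1 : S (adm o w u) = adm o (S w) u + adm o w (S u) := hS w u
  have h6 : (S (adm o w u)).1.1 i j = (adm o (S w) u).1.1 i j + (adm o w (S u)).1.1 i j := by
    rw [h1]; rfl
  rw [LinearMap.sub_apply, LinearMap.sub_apply, LinearMap.sub_apply, map_sub,
    Submodule.coe_sub _ (S w), map_sub, LinearMap.sub_apply]
  change (S (adm o w u)).1.1 i j - (adm o v (adm o w u)).1.1 i j =
    (adm o (S w) u).1.1 i j - (adm o (adm o v w : m o) u).1.1 i j +
      ((adm o w (S u)).1.1 i j - (adm o w (adm o v u)).1.1 i j)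
  rw [h3, h4, h5, h6, sub_zero, sub_zero, sub_zero]

/-- A derivation differs from the action of an element of `𝔤 ⊕ 𝔨` by the map `y ↦ [v,y]_𝔪` for
some `v ∈ 𝔭`. -/
theorem exists_sub_adm_eq_adm {T : Module.End ℝ (m o)} (hT : T ∈ der o) :
    ∃ x ∈ (g o).toSubmodule ⊔ (k o).toSubmodule, ∃ v : m o, v.1 ∈ P o ∧
      T - adm o x = adm o v := by
  obtain ⟨x, hx, v, hv, y, hy, hxy⟩ := exists_eq_adm_on_scal hT
  have hx' := mem_sup_of_mem_g hx
  set S := T - adm o x with hS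
  have hSd : S ∈ der o := (der o).sub_mem hT (adm_mem_der hx')
  set v' : m o := ⟨v, Submodule.mem_sup_right hv⟩ with hv'
  set D := S - adm o v with hDdef
  have hu : ∀ r ∈ ({qI, qJ, qK} : Set ℍ[ℝ]), D (scal o r) = 0 := by
    intro r hr
    rw [hDdef, hS, LinearMap.sub_apply, LinearMap.sub_apply, hxy r hr, hy, map_add,
      LinearMap.add_apply, add_sub_cancel_left, sub_self]
  have hD : IsRelDer D :=
    { map_scal := fun r => by
        rw [scal_eq, map_add, map_add, map_smul, map_smul, map_smul, hu qI (by simp),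
          hu qJ (by simp), hu qK (by simp)]
        simp
      leibniz := fun a ha z => sub_adm_leibniz hSd v' ha z }
  obtain ⟨x₂, hx₂, hDx⟩ := hD.exists_eq_adm fun w u hw hu i j hi hj =>
    sub_adm_leibniz_P hSd (v := v') hv hw hu hi hj
  refine ⟨x + x₂, Submodule.add_mem _ hx' hx₂, v', hv, ?_⟩
  rw [map_add, ← sub_sub, ← hS, ← hDx, hDdef, sub_sub_cancel]
end QSp

theorem mainTheorem6 (p q : ℕ) (o : Fin p ⊕ Fin q) :
    (∀ x ∈ (QSp.g o).toSubmodule ⊔ (QSp.k o).toSubmodule, ∀ y : QSp.m o,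
      ((QSp.adm o x y : QSp.m o) : QSp.sp p q) = ⁅x, (y : QSp.sp p q)⁆) ∧
    (QSp.der o).toSubmodule =
      ((QSp.g o).toSubmodule ⊔ (QSp.k o).toSubmodule).map (QSp.adm o) ∧
    ∀ x ∈ QSp.P o, QSp.adm o x ∈ QSp.der o → x = 0 := by
  refine ⟨fun x hx y => QSp.coe_adm hx y, le_antisymm (fun T hT => ?_) ?_, fun x hx h => ?_⟩
  · obtain ⟨x, hx, v, hv, hTv⟩ := QSp.exists_sub_adm_eq_adm hT
    have hv0 : v = 0 := QSp.eq_zero_of_adm_mem_der hv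
      (hTv ▸ (QSp.der o).sub_mem hT (QSp.adm_mem_der hx))
    refine ⟨x, hx, (sub_eq_zero.1 ?_).symm⟩
    rw [hTv, hv0, Submodule.coe_zero, map_zero]
  · rintro _ ⟨x, hx, rfl⟩
    exact QSp.adm_mem_der hx
  · have h0 := QSp.eq_zero_of_adm_mem_der (v := ⟨x, Submodule.mem_sup_right hx⟩) hx h
    exact congrArg Subtype.val h0
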